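/- For every finite simple graph $H$, the Kronecker product $H\wedge P_3$ of $H$ with the path $P_3$ on three vertices is not $3$-polytopal, that is, it is not both planar and $3$-connected. Here the Kronecker product $H\wedge J$ has vertex set $V(H)\times V(J)$, with $(a,x)$ and $(b,y)$ adjacent if and only if $ab\in E(H)$ and $xy\in E(J)$; a graph is planar if it can be drawn in the plane so that no edges cross except at vertices; and a graph is $3$-connected if it has more than $3$ vertices and remains connected whenever fewer than $3$ vertices are removed. -/

import Mathlib

namespace SimpleGraph

/-- The Kronecker (direct, tensor) product `H ∧ J` of two simple graphs: its vertex set is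
`V(H) × V(J)`, and `(a, x)` is adjacent to `(b, y)` iff `ab ∈ E(H)` and `xy ∈ E(J)`. -/
def kroneckerProd {V W : Type*} (H : SimpleGraph V) (J : SimpleGraph W) :
    SimpleGraph (V × W) where
  Adj p q := H.Adj p.1 q.1 ∧ J.Adj p.2 q.2
  symm := ⟨fun _ _ h => ⟨h.1.symm, h.2.symm⟩⟩
  loopless := ⟨fun _ h => H.irrefl h.1⟩

/-- A graph is `k`-connected if it has more than `k` vertices and, however fewer than `k` vertices
are removed, the remaining graph is connected. -/
def IsVertexConnected {V : Type*} (G : SimpleGraph V) (k : ℕ) : Prop :=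
  (k : ℕ∞) < ENat.card V ∧
    ∀ S : Finset V, S.card < k → (G.induce ((S : Set V)ᶜ)).Connected

/-- A drawing of `G` in the plane without crossings: the vertices are distinct points, every edge
is a simple continuous arc between its two end vertices that passes through no other vertex, and
two different edges meet only in vertices. -/
structure PlaneEmbedding {V : Type*} (G : SimpleGraph V) where
  /-- the point that represents a vertex -/
  pos : V → EuclideanSpace ℝ (Fin 2)
  /-- the curve that represents an edge, directed from `u` to `v` -/
  arc : ∀ {u v : V}, G.Adj u v → _root_.Path (pos u) (pos v)
  pos_injective : Function.Injective pos
  /-- the two directions of an edge give the same curve, reversed -/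
  arc_symm : ∀ {u v : V} (h : G.Adj u v), arc h.symm = (arc h).symm
  arc_injective : ∀ {u v : V} (h : G.Adj u v), Function.Injective (arc h)
  eq_or_eq_of_pos_mem_arc : ∀ {u v : V} (h : G.Adj u v) (w : V),
    pos w ∈ Set.range (arc h) → w = u ∨ w = v
  arc_inter_arc : ∀ {u v u' v' : V} (h : G.Adj u v) (h' : G.Adj u' v'), s(u, v) ≠ s(u', v') →
    Set.range (arc h) ∩ Set.range (arc h') ⊆ Set.range pos

/-- A graph is planar if it can be drawn in the plane without crossings. -/
def IsPlanar {V : Type*} (G : SimpleGraph V) : Prop :=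
  Nonempty G.PlaneEmbedding

/-- A graph is `3`-polytopal if it is planar and `3`-connected. -/
def IsThreePolytopal {V : Type*} (G : SimpleGraph V) : Prop :=
  G.IsPlanar ∧ G.IsVertexConnected 3

end SimpleGraph

/-! The two copies of a vertex of $H$ over the ends of $P_3$ are twins: they have the same
neighbours. In a planar 3-connected graph twins are adjacent to all other vertices (`adj_of_twins`),
since a third vertex off their neighbourhood would yield a drawing of $K_{3,3}$ with the twins as
two of the hubs. But copies over the same end are never adjacent.

$K_{3,3}$ is excluded by a winding-number parity count, which needs only that edges without common
end are disjoint. So the three paths from the third hub may cross one another. -/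

/-! ### Continuous logarithms -/

theorem exists_continuous_exp_eq {A : Type*} [TopologicalSpace A] [SimplyConnectedSpace A]
    [LocallyPathConnectedSpace A] {f : A → ℂ} (hf : Continuous f) (h0 : ∀ x, f x ≠ 0) :
    ∃ g : A → ℂ, Continuous g ∧ ∀ x, Complex.exp (g x) = f x := by
  obtain ⟨a⟩ := (inferInstance : Nonempty A)
  obtain ⟨F, ⟨-, hF⟩, -⟩ := Complex.isCoveringMapOn_exp.existsUnique_continuousMap_lifts
    (⟨f, hf⟩ : C(A, ℂ)) (a₀ := a) (Complex.exp_log (h0 a)) h0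
  exact ⟨F, F.continuous, fun x => congrFun hF x⟩

theorem sub_eq_sub_of_exp_eq {A : Type*} [TopologicalSpace A] [SimplyConnectedSpace A]
    [LocallyPathConnectedSpace A] {g g' : A → ℂ} (hg : Continuous g) (hg' : Continuous g')
    (h : ∀ x, Complex.exp (g x) = Complex.exp (g' x)) (x y : A) :
    g y - g x = g' y - g' x := by
  have key := (Complex.isCoveringMapOn_exp.existsUnique_continuousMap_lifts
    (⟨fun a => Complex.exp (g a), by fun_prop⟩ : C(A, ℂ)) (a₀ := x) (e₀ := g x) rfl
    (fun a => Complex.exp_ne_zero _)).unique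
    (y₁ := ⟨g, hg⟩) (y₂ := ⟨fun a => g' a + (g x - g' x), by fun_prop⟩) ⟨rfl, rfl⟩
    ⟨by simp, by
      funext a
      simp [Complex.exp_add, Complex.exp_sub, h]⟩
  have := DFunLike.congr_fun key y
  simp only [ContinuousMap.coe_mk] at this
  rw [this]; ring

/-- `L` is the total change of a continuous logarithm of `f` along `[0, 1]`. -/
def IsLogChange (f : ℝ → ℂ) (L : ℂ) : Prop :=
  ∃ g : ℝ → ℂ, Continuous g ∧ (∀ t, Complex.exp (g t) = f t) ∧ g 1 - g 0 = L

theorem IsLogChange.unique {f : ℝ → ℂ} {L L' : ℂ} (h : IsLogChange f L) (h' : IsLogChange f L') :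
    L = L' := by
  obtain ⟨g, hg, hgf, rfl⟩ := h
  obtain ⟨g', hg', hgf', rfl⟩ := h'
  exact sub_eq_sub_of_exp_eq hg hg' (fun x => by rw [hgf, hgf']) 0 1

theorem IsLogChange.neg {f : ℝ → ℂ} {L : ℂ} (h : IsLogChange f L) :
    IsLogChange (fun t => -f t) L := by
  obtain ⟨g, hg, hgf, rfl⟩ := h
  exact ⟨fun t => g t + Real.pi * Complex.I, by fun_prop,
    fun t => by rw [Complex.exp_add, hgf, Complex.exp_pi_mul_I, mul_neg_one], by ring⟩

theorem exists_isLogChange {f : ℝ → ℂ} (hf : Continuous f) (h0 : ∀ x, f x ≠ 0) :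
    ∃ L, IsLogChange f L := by
  obtain ⟨g, hg, h⟩ := exists_continuous_exp_eq hf h0
  exact ⟨_, g, hg, h, rfl⟩

theorem IsLogChange.exists_int {f : ℝ → ℂ} {L u v : ℂ} (h : IsLogChange f L)
    (hu : Complex.exp u = f 0) (hv : Complex.exp v = f 1) :
    ∃ n : ℤ, L = v - u + n * (2 * Real.pi * Complex.I) := by
  obtain ⟨g, hg, hgf, rfl⟩ := h
  refine Complex.exp_eq_exp_iff_exists_int.1 ?_
  rw [Complex.exp_sub, Complex.exp_sub, hgf, hgf, hu, hv]

/-- The total change of a logarithm around the boundary of the unit square vanishes. -/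
theorem logChange_square {f : ℝ × ℝ → ℂ} (hf : Continuous f) (h0 : ∀ x, f x ≠ 0)
    {Lb Lt Ll Lr : ℂ} (hb : IsLogChange (fun s => f (s, 0)) Lb)
    (ht : IsLogChange (fun s => f (s, 1)) Lt) (hl : IsLogChange (fun t => f (0, t)) Ll)
    (hr : IsLogChange (fun t => f (1, t)) Lr) : Lb + Lr = Ll + Lt := by
  obtain ⟨g, hg, h⟩ := exists_continuous_exp_eq hf h0
  rw [hb.unique ⟨fun s => g (s, 0), by fun_prop, fun _ => h _, rfl⟩,
    ht.unique ⟨fun s => g (s, 1), by fun_prop, fun _ => h _, rfl⟩,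
    hl.unique ⟨fun s => g (0, s), by fun_prop, fun _ => h _, rfl⟩,
    hr.unique ⟨fun s => g (1, s), by fun_prop, fun _ => h _, rfl⟩]
  ring

/-- Fixes logarithms of opposite differences to differ by exactly πi, so that later multiples of 2πi
can be counted. -/
theorem exists_exp_eq_sub_add_pi {a : Fin 3 → ℂ} (ha : Function.Injective a) :
    ∃ P : Fin 3 → Fin 3 → ℂ, (∀ i k, i ≠ k → Complex.exp (P i k) = a i - a k) ∧
      ∀ i k, i < k → P k i = P i k + Real.pi * Complex.I := by
  refine ⟨fun i k => if i < k then Complex.log (a i - a k)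
    else Complex.log (a k - a i) + Real.pi * Complex.I, fun i k hik => ?_, fun i k hik => ?_⟩
  · have h1 : a i - a k ≠ 0 := sub_ne_zero.2 (ha.ne hik)
    have h2 : a k - a i ≠ 0 := sub_ne_zero.2 (ha.ne hik.symm)
    dsimp only
    split_ifs
    · exact Complex.exp_log h1
    · rw [Complex.exp_add, Complex.exp_log h2, Complex.exp_pi_mul_I]; ring
  · simp [hik, hik.not_gt]

/-! ### Nonplanarity of $K_{3,3}$ -/

/-- `K₃,₃` cannot be drawn in the plane so that any two edges without common end are disjoint. -/
theorem not_disjoint_paths_complex {a b : Fin 3 → ℂ} (γ : ∀ i j, Path (a i) (b j))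
    (h : ∀ i j k l, i ≠ k → j ≠ l → ∀ s t, γ i j s ≠ γ k l t) : False := by
  have hE : ∀ i j k l, i ≠ k → j ≠ l → ∀ s t, (γ i j).extend s ≠ (γ k l).extend t :=
    fun i j k l hik hjl s t => h i j k l hik hjl _ _
  have other : ∀ j : Fin 3, ∃ l, j ≠ l := by decide
  have hA : ∀ i j k, i ≠ k → ∀ t, (γ i j).extend t - a k ≠ 0 := by
    intro i j k hik t
    obtain ⟨l, hl⟩ := other j
    simpa [sub_eq_zero] using hE i j k l hik hl t 0
  have hB : ∀ i j l, j ≠ l → ∀ t, (γ i j).extend t - b l ≠ 0 := by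
    intro i j l hjl t
    obtain ⟨k, hk⟩ := other i
    simpa [sub_eq_zero] using hE i j k l hk hjl t 1
  have hab : ∀ j k, b j - a k ≠ 0 := by
    intro j k
    obtain ⟨i, hi⟩ := other k
    simpa using hA i j k hi.symm 1
  have ha : Function.Injective a := by
    intro i k hik
    by_contra hne
    simpa [hik] using hA i 0 k hne 0
  have hb : Function.Injective b := by
    intro j l hjl
    by_contra hne
    simpa [hjl] using hB 0 j l hne 1
  obtain ⟨P, hP, hP'⟩ := exists_exp_eq_sub_add_pi ha
  obtain ⟨R, hR, hR'⟩ := exists_exp_eq_sub_add_pi hb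
  have hLA : ∀ k i j, ∃ L, i ≠ k → IsLogChange (fun t => (γ i j).extend t - a k) L := by
    intro k i j
    by_cases hik : i = k
    · exact ⟨0, fun h => absurd hik h⟩
    · obtain ⟨L, hL⟩ := exists_isLogChange (f := fun t => (γ i j).extend t - a k)
        (by fun_prop) (hA i j k hik)
      exact ⟨L, fun _ => hL⟩
  have hLB : ∀ l i j, ∃ L, j ≠ l → IsLogChange (fun t => (γ i j).extend t - b l) L := by
    intro l i j
    by_cases hjl : j = l
    · exact ⟨0, fun h => absurd hjl h⟩
    · obtain ⟨L, hL⟩ := exists_isLogChange (f := fun t => (γ i j).extend t - b l)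
        (by fun_prop) (hB i j l hjl)
      exact ⟨L, fun _ => hL⟩
  choose LA hLA using hLA
  choose LB hLB using hLB
  have hm : ∀ k i j, ∃ m : ℤ, i ≠ k →
      LA k i j = Complex.log (b j - a k) - P i k + m * (2 * Real.pi * Complex.I) := by
    intro k i j
    by_cases hik : i = k
    · exact ⟨0, fun h => absurd hik h⟩
    · obtain ⟨m, hm⟩ := (hLA k i j hik).exists_int (u := P i k) (v := Complex.log (b j - a k))
        (by simp [hP i k hik]) (by simp [Complex.exp_log (hab j k)])
      exact ⟨m, fun _ => hm⟩
  have hn : ∀ l i j, ∃ n : ℤ, j ≠ l →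
      LB l i j = R j l - (Complex.log (b l - a i) + Real.pi * Complex.I)
        + n * (2 * Real.pi * Complex.I) := by
    intro l i j
    by_cases hjl : j = l
    · exact ⟨0, fun h => absurd hjl h⟩
    · obtain ⟨n, hn⟩ := (hLB l i j hjl).exists_int
        (u := Complex.log (b l - a i) + Real.pi * Complex.I) (v := R j l)
        (by simp [Complex.exp_add, Complex.exp_log (hab l i)]) (by simp [hR j l hjl])
      exact ⟨n, fun _ => hn⟩
  choose m hm using hm
  choose n hn using hn
  -- The difference of points on two independent edges has no zero on the square of parameters.
  have rel : ∀ i j k l, i ≠ k → j ≠ l → LA k i j + LB j k l = LA i k l + LB l i j := by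
    intro i j k l hik hjl
    refine logChange_square (f := fun x => (γ i j).extend x.1 - (γ k l).extend x.2)
      (by fun_prop) (fun x => sub_ne_zero.2 (hE i j k l hik hjl _ _)) ?_ ?_ ?_ ?_
    · simpa using hLA k i j hik
    · simpa using hLB l i j hjl
    · simpa using (hLA i k l hik.symm).neg
    · simpa using (hLB j k l hjl.symm).neg
  have hpi : (2 * Real.pi * Complex.I : ℂ) ≠ 0 := Complex.two_pi_I_ne_zero
  -- The half turns from `hP'` and `hR'` add up to one full turn here; in `gt_rel` they cancel.
  have lt_rel : ∀ i j k l, i < k → j < l → m k i j + n j k l = m i k l + n l i j - 1 := by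
    intro i j k l hik hjl
    have h1 := rel i j k l hik.ne hjl.ne
    rw [hm k i j hik.ne, hm i k l hik.ne', hn j k l hjl.ne', hn l i j hjl.ne, hP' i k hik,
      hR' j l hjl] at h1
    have h2 : ((m k i j + n j k l : ℤ) : ℂ) = ((m i k l + n l i j - 1 : ℤ) : ℂ) := by
      apply mul_right_cancel₀ hpi
      push_cast
      linear_combination h1
    exact_mod_cast h2
  have gt_rel : ∀ i j k l, i < k → l < j → m k i j + n j k l = m i k l + n l i j := by
    intro i j k l hik hjl
    have h1 := rel i j k l hik.ne hjl.ne'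
    rw [hm k i j hik.ne, hm i k l hik.ne', hn j k l hjl.ne, hn l i j hjl.ne', hP' i k hik,
      hR' l j hjl] at h1
    have h2 : ((m k i j + n j k l : ℤ) : ℂ) = ((m i k l + n l i j : ℤ) : ℂ) := by
      apply mul_right_cancel₀ hpi
      push_cast
      linear_combination h1
    exact_mod_cast h2
  have h01 : (0 : Fin 3) < 1 := by decide
  have h02 : (0 : Fin 3) < 2 := by decide
  have h12 : (1 : Fin 3) < 2 := by decide
  have e : ∀ i k, i < k → _ := fun i k hik =>
    And.intro (And.intro (lt_rel i 0 k 1 hik h01) (And.intro (lt_rel i 0 k 2 hik h02)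
      (lt_rel i 1 k 2 hik h12))) (And.intro (gt_rel i 1 k 0 hik h01)
      (And.intro (gt_rel i 2 k 0 hik h02) (gt_rel i 2 k 1 hik h12)))
  have e1 := e 0 1 h01
  have e2 := e 0 2 h02
  have e3 := e 1 2 h12
  -- Each integer occurs in exactly two of the 18 relations, nine of which carry a -1; the sum
  -- modulo 2 reads 0 = 1.
  omega

theorem not_disjoint_paths {a b : Fin 3 → EuclideanSpace ℝ (Fin 2)} (γ : ∀ i j, Path (a i) (b j))
    (h : ∀ i j k l, i ≠ k → j ≠ l → ∀ s t, γ i j s ≠ γ k l t) : False := by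
  let e := Complex.orthonormalBasisOneI.repr.symm
  exact not_disjoint_paths_complex (fun i j => (γ i j).map e.continuous)
    (fun i j k l hik hjl s t => by simpa using h i j k l hik hjl s t)

/-! ### Twins in planar 3-connected graphs -/

namespace SimpleGraph

variable {V : Type*} {G : SimpleGraph V}

namespace PlaneEmbedding

theorem disjoint_arc (E : G.PlaneEmbedding) {u v u' v' : V} (h : G.Adj u v) (h' : G.Adj u' v')
    (huu : u ≠ u') (huv : u ≠ v') (hvu : v ≠ u') (hvv : v ≠ v') :
    Disjoint (Set.range (E.arc h)) (Set.range (E.arc h')) := by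
  rw [Set.disjoint_left]
  intro P hP hP'
  obtain ⟨w, rfl⟩ := E.arc_inter_arc h h' (by simp [huu, huv]) ⟨hP, hP'⟩
  rcases E.eq_or_eq_of_pos_mem_arc h w hP with rfl | rfl <;>
    rcases E.eq_or_eq_of_pos_mem_arc h' _ hP' with rfl | rfl <;> contradiction

/-- The union of the arcs of the edges at `p` and `p'` whose other end lies in `s`. -/
def star (E : G.PlaneEmbedding) (p p' : V) (s : Set V) : Set (EuclideanSpace ℝ (Fin 2)) :=
  {P | ∃ q x, ∃ h : G.Adj q x, (q = p ∨ q = p') ∧ x ∈ s ∧ P ∈ Set.range (E.arc h)}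

theorem star_mono (E : G.PlaneEmbedding) (p p' : V) {s t : Set V} (hst : s ⊆ t) :
    E.star p p' s ⊆ E.star p p' t :=
  fun _ ⟨q, x, h, hq, hx, hP⟩ => ⟨q, x, h, hq, hst hx, hP⟩

theorem joinedIn_compl_star (E : G.PlaneEmbedding) {p p' u v : V} {s : Set V} (h : G.Adj u v)
    (hup : u ≠ p) (hup' : u ≠ p') (hvp : v ≠ p) (hvp' : v ≠ p')
    (hu : ∀ q x, G.Adj q x → (q = p ∨ q = p') → x ∈ s → x ≠ u ∧ x ≠ v) :
    JoinedIn (E.star p p' s)ᶜ (E.pos u) (E.pos v) := by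
  refine ⟨E.arc h, fun t => ?_⟩
  rintro ⟨q, x, hqx, hq, hx, hP⟩
  obtain ⟨hxu, hxv⟩ := hu q x hqx hq hx
  refine (E.disjoint_arc h hqx ?_ hxu.symm ?_ hxv.symm).le_bot ⟨⟨t, rfl⟩, hP⟩
  · rcases hq with rfl | rfl <;> assumption
  · rcases hq with rfl | rfl <;> assumption

/-- Two hubs with common neighbours `x 0`, `x 1`, `x 2`, and a third vertex joined to each of them
off the arcs from the hubs to the other two, would form a drawing of `K₃,₃`. -/
theorem not_joinedIn_of_adj (E : G.PlaneEmbedding) {p p' z : V} (hpp : p ≠ p') {x : Fin 3 → V}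
    (hx : Function.Injective x) (hp : ∀ j, G.Adj p (x j)) (hp' : ∀ j, G.Adj p' (x j))
    (hne : ∀ j, x j ≠ p ∧ x j ≠ p')
    (hz : ∀ j, JoinedIn (E.star p p' {x j}ᶜ)ᶜ (E.pos z) (E.pos (x j))) : False := by
  have key : ∀ i j, ∃ γ : _root_.Path (E.pos (![p, p', z] i)) (E.pos (x j)),
      (i = 0 → Set.range γ = Set.range (E.arc (hp j))) ∧
      (i = 1 → Set.range γ = Set.range (E.arc (hp' j))) ∧
      (i = 2 → ∀ t, γ t ∉ E.star p p' {x j}ᶜ) := by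
    intro i j
    match i with
    | 0 => exact ⟨E.arc (hp j), fun _ => rfl, fun h => absurd h (by decide), fun h => absurd h (by decide)⟩
    | 1 => exact ⟨E.arc (hp' j), fun h => absurd h (by decide), fun _ => rfl, fun h => absurd h (by decide)⟩
    | 2 =>
      obtain ⟨γ, hγ⟩ := hz j
      exact ⟨γ, fun h => absurd h (by decide), fun h => absurd h (by decide), fun _ => hγ⟩
  choose γ h0 h1 h2 using key
  have hub : ∀ {j l}, j ≠ l → Disjoint (Set.range (γ 0 j)) (Set.range (γ 1 l)) := by
    intro j l hjl
    rw [h0 0 j rfl, h1 1 l rfl]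
    exact E.disjoint_arc _ _ hpp (hne l).1.symm (hne j).2 (hx.ne hjl)
  have third0 : ∀ {j l}, j ≠ l → Disjoint (Set.range (γ 0 j)) (Set.range (γ 2 l)) := by
    intro j l hjl
    rw [Set.disjoint_right]
    rintro _ ⟨t, rfl⟩ ht
    exact h2 2 l rfl t ⟨p, x j, hp j, .inl rfl, hx.ne hjl, h0 0 j rfl ▸ ht⟩
  have third1 : ∀ {j l}, j ≠ l → Disjoint (Set.range (γ 1 j)) (Set.range (γ 2 l)) := by
    intro j l hjl
    rw [Set.disjoint_right]
    rintro _ ⟨t, rfl⟩ ht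
    exact h2 2 l rfl t ⟨p', x j, hp' j, .inr rfl, hx.ne hjl, h1 1 j rfl ▸ ht⟩
  refine not_disjoint_paths γ fun i j k l hik hjl s t => ?_
  suffices Disjoint (Set.range (γ i j)) (Set.range (γ k l)) from
    this.ne_of_mem ⟨s, rfl⟩ ⟨t, rfl⟩
  match i, k with
  | 0, 0 | 1, 1 | 2, 2 => exact absurd rfl hik
  | 0, 1 => exact hub hjl
  | 1, 0 => exact (hub hjl.symm).symm
  | 0, 2 => exact third0 hjl
  | 2, 0 => exact (third0 hjl.symm).symm
  | 1, 2 => exact third1 hjl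
  | 2, 1 => exact (third1 hjl.symm).symm

end PlaneEmbedding

/-- In a planar `3`-connected graph, two vertices with the same neighbours are adjacent to every
other vertex. -/
theorem IsVertexConnected.adj_of_twins [Finite V] (hG : G.IsVertexConnected 3)
    (E : G.PlaneEmbedding) {p p' z : V} (hpp : p ≠ p') (htwin : ∀ x, G.Adj p x ↔ G.Adj p' x)
    (hzp : z ≠ p) (hzp' : z ≠ p') : G.Adj p z := by
  classical
  have := Fintype.ofFinite V
  by_contra hadj
  have hnadj : ¬ G.Adj p p' := fun h => G.irrefl ((htwin p').1 h)
  -- `R` plays the role of the third hub and `X` is its boundary, made of common neighbours of the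
  -- twins.
  let R : Set V := {y | y ≠ p ∧ y ≠ p' ∧ ¬ G.Adj p y ∧
    JoinedIn (E.star p p' Set.univ)ᶜ (E.pos z) (E.pos y)}
  let X : Finset V := {x | G.Adj p x ∧ ∃ r ∈ R, G.Adj r x}
  have hub_adj : ∀ q x, G.Adj q x → (q = p ∨ q = p') → G.Adj p x := by
    rintro q x h (rfl | rfl)
    exacts [h, (htwin x).2 h]
  have hzR : z ∈ R := by
    refine ⟨hzp, hzp', hadj, JoinedIn.refl ?_⟩
    rintro ⟨q, x, h, hq, -, hP⟩
    rcases E.eq_or_eq_of_pos_mem_arc h z hP with rfl | rfl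
    · exact hq.elim hzp hzp'
    · exact hadj (hub_adj _ _ h hq)
  have hstep : ∀ r ∈ R, ∀ y, G.Adj r y → y ∉ X → y ∈ R := by
    rintro r hr y hry hyX
    have hpy : ¬ G.Adj p y := fun h => hyX (by simpa [X] using ⟨h, r, hr, hry⟩)
    obtain ⟨hrp, hrp', hpr, hj⟩ := hr
    have hyp : y ≠ p := by rintro rfl; exact hpr hry.symm
    have hyp' : y ≠ p' := by rintro rfl; exact hpr ((htwin r).2 hry.symm)
    refine ⟨hyp, hyp', hpy, hj.trans (E.joinedIn_compl_star hry hrp hrp' hyp hyp' ?_)⟩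
    rintro q x hqx hq -
    have hpx := hub_adj q x hqx hq
    exact ⟨by rintro rfl; exact hpr hpx, by rintro rfl; exact hpy hpx⟩
  -- `X` separates `z` from `p`: by `hstep`, a walk avoiding `X` never leaves `R`.
  have hcard : 2 < X.card := by
    by_contra hlt
    have hconn := hG.2 X (by omega)
    have hzX : z ∉ X := by simp [X, hadj]
    have hpX : p ∉ X := by simp [X]
    obtain ⟨w⟩ := hconn.preconnected ⟨z, hzX⟩ ⟨p, hpX⟩
    have hwalk : ∀ {u v} (_ : (G.induce (X : Set V)ᶜ).Walk u v), u.1 ∈ R → v.1 ∈ R := by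
      intro u v w
      induction w with
      | nil => exact id
      | @cons u v _ h _ ih => exact fun hu => ih (hstep _ hu _ h v.2)
    exact (hwalk w hzR).1 rfl
  obtain ⟨x⟩ : Nonempty (Fin 3 ↪ X) :=
    Function.Embedding.nonempty_of_card_le (by simpa using Nat.succ_le_of_lt hcard)
  have hX : ∀ j, G.Adj p (x j) ∧ ∃ r ∈ R, G.Adj r (x j) := fun j =>
    (Finset.mem_filter.1 (x j).2).2
  have hne : ∀ j, (x j : V) ≠ p ∧ (x j : V) ≠ p' := fun j =>
    ⟨(hX j).1.ne', fun h => hnadj (h ▸ (hX j).1)⟩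
  refine E.not_joinedIn_of_adj hpp (x := fun j => x j) (z := z)
    (Subtype.val_injective.comp x.injective) (fun j => (hX j).1) (fun j => (htwin _).1 (hX j).1)
    hne fun j => ?_
  -- Go from `z` to `r` off all hub arcs, then along the edge to `x j`, which can meet only the hub
  -- arcs ending at `x j`.
  obtain ⟨r, ⟨hrp, hrp', hpr, hj⟩, hrx⟩ := (hX j).2
  refine (hj.mono (Set.compl_subset_compl.2 (E.star_mono p p' (Set.subset_univ _)))).trans
    (E.joinedIn_compl_star hrx hrp hrp' (hne j).1 (hne j).2 fun q y hqy hq hy => ⟨?_, hy⟩)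
  rintro rfl
  exact hpr (hub_adj q y hqy hq)

end SimpleGraph

/-! ### The product with $P_3$ -/

theorem proposition2 {V : Type*} [Finite V] (H : SimpleGraph V) :
    ¬ (H.kroneckerProd (SimpleGraph.pathGraph 3)).IsThreePolytopal := by
  rintro ⟨⟨E⟩, hG⟩
  have : Nontrivial V := by
    by_contra hV
    rw [not_nontrivial_iff_subsingleton] at hV
    have h3 := hG.1
    rw [ENat.card_eq_coe_natCard, Nat.card_prod, Nat.card_fin] at h3
    have h1 : Nat.card V ≤ 1 := Finite.card_le_one_iff_subsingleton.2 hV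
    have h4 : 3 < Nat.card V * 3 := by exact_mod_cast h3
    omega
  obtain ⟨b, c, hbc⟩ := exists_pair_ne V
  have htwin : ∀ y : Fin 3, (SimpleGraph.pathGraph 3).Adj 0 y ↔
      (SimpleGraph.pathGraph 3).Adj 2 y := by
    intro y
    fin_cases y <;> simp [SimpleGraph.pathGraph_adj]
  have h := hG.adj_of_twins E (p := (b, 0)) (p' := (b, 2)) (z := (c, 0)) (by simp)
    (fun x => and_congr_right fun _ => htwin x.2) (by simpa using hbc.symm) (by simp)
  exact (SimpleGraph.pathGraph 3).irrefl h.2
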